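/- **Setting.** Let $\beta$ be an analytic (real- or complex-valued) function on $\mathbb R$. For a positive integer $\omega$ let $g_\omega(y)=e^{-\omega\beta(y)}$ and $f_\omega(x)=\frac1{2\pi}\int_{\mathbb R}g_\omega(y)e^{ixy}\,dy$, and assume $\int_{\mathbb R}|f_\omega(x)|\,dx=1$ for every $\omega\ge 1$. Let $\sigma_+$ be the indicator function of $(0,\infty)$. Let $A=\mathbb C\delta\oplus A_0$, where $A_0$ is the space of bounded integrable functions $\mathbb R\to\mathbb C$ that are continuous on $(0,\infty)$ and on $(-\infty,0)$, be the commutative algebra whose product is convolution and whose unit is $\delta$. Define linear maps $R:A\to A$ by $R(\delta)=\delta$ and $R(f)=f\sigma_+$ for $f\in A_0$, and $\Theta:A\to\mathbb C$ by $\Theta(\delta)=1$ and $\Theta(f)=\int_{\mathbb R}f$ for $f\in A_0$. Put $\gamma=f_1\in A$. Let $\mathbf{Hqsh}$ be the quasi-shuffle algebra over $\mathbb C$ on words in positive integers, with the deconcatenation coproduct, and let $\star$ be the resulting convolution product of linear maps $\mathbf{Hqsh}\to A$, with unit $e$ ($e(\emptyset)=\delta$, and $e=0$ on non-empty words). Let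 $\mathcal I(\emptyset)=\delta$, $\mathcal I(\omega)=\gamma^{\omega}$ on words with one letter $\omega$, $\mathcal I=0$ on longer words, and $a=\mathcal I-e$. Put $(\mathcal Ra)^{[0]}=e$, $(\mathcal Ra)^{[n+1]}=R\circ\big((\mathcal Ra)^{[n]}\star a\big)$ and $F_{|t=-1}=\sum_{n\ge0}(-1)^n(\mathcal Ra)^{[n]}$. The diffusion character is $\phi_{\mathrm{diffusion}}=\Theta\circ F_{|t=-1}$. Explicitly, on a word, $$\phi_{\mathrm{diffusion}}(\omega_1\cdots\omega_n)=(-1)^n\,\Theta\big(R(\cdots R(R(\gamma^{\omega_1})\gamma^{\omega_2})\cdots\gamma^{\omega_n})\big).$$ Let $\mathbf{Hck}$ be the Connes–Kreimer algebra over $\mathbb C$ of non-planar rooted forests with nodes decorated by positive integers. Let $\alpha:\mathbf{Hck}\to\mathbf{Hqsh}$ be the arborification morphism, i.e. the unique algebra morphism with $\alpha\circ B^+_\omega=L_\omega\circ\alpha$ for all $\omega$, where $B_\omega^+$ grafts the trees of a forest on a new root decorated by $\omega$ and $L_\omega$ adds the letter $\omega$ in front of a word. Let $\mathrm{rev}$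 be the reversal of words. The antiarborified diffusion character is $$\phi_{\mathrm{diffusion}}^{\gg}=\Theta\circ F_{|t=-1}\circ\mathrm{rev}\circ\alpha .$$ **Proposition.** For every decorated forest $\underline\omega^<$ with $r$ nodes, with decorations $\omega_1,\dots,\omega_r$, $$\phi_{\mathrm{diffusion}}^{\gg}(\underline\omega^<)=(-1)^r\int_{\mathbb R^r}f_{\omega_1}(x_1)\cdots f_{\omega_r}(x_r)\,\sigma_+(\hat x_1)\cdots\sigma_+(\hat x_r)\,dx_1\cdots dx_r ,$$ where the integral converges absolutely and $\hat x_i$ is the sum of the $x_j$ over the node $i$ itself and all its descendants $j$. -/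

import Mathlib

open MeasureTheory

noncomputable section

namespace DiffusionAverage

/-- Planar forests decorated by positive integers: the empty forest, or a first tree with root
decorated by `ω` and forest of children `c`, followed by the remaining forest `r`. -/
inductive PForest : Type
  | nil : PForest
  | cons (ω : ℕ+) (c r : PForest) : PForest

namespace PForest

/-- Concatenation of planar forests. -/
def append : PForest → PForest → PForest
  | nil, G => G
  | cons ω c r, G => cons ω c (append r G)

/-- Exchange of two neighbouring sibling trees, somewhere in the forest. -/
inductive Step : PForest → PForest → Prop
  | swap (ω : ℕ+) (c : PForest) (ω' : ℕ+) (c' r : PForest) :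
      Step (cons ω c (cons ω' c' r)) (cons ω' c' (cons ω c r))
  | child (ω : ℕ+) {c c' : PForest} (r : PForest) : Step c c' → Step (cons ω c r) (cons ω c' r)
  | rest (ω : ℕ+) (c : PForest) {r r' : PForest} : Step r r' → Step (cons ω c r) (cons ω c r')

/-- The nodes of a forest: the root of the first tree, the nodes below that root, and the nodes of
the other trees. -/
inductive Node : PForest → Type
  | root (ω : ℕ+) (c r : PForest) : Node (cons ω c r)
  | under (ω : ℕ+) {c : PForest} (r : PForest) (i : Node c) : Node (cons ω c r)
  | beside (ω : ℕ+) (c : PForest) {r : PForest} (i : Node r) : Node (cons ω c r)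

/-- The arborescent order: `Desc i j` says that `j` is a descendant of `i`, or `i` itself. -/
inductive Desc : {F : PForest} → Node F → Node F → Prop
  | root_root (ω : ℕ+) (c r : PForest) : Desc (Node.root ω c r) (Node.root ω c r)
  | root_below (ω : ℕ+) {c : PForest} (r : PForest) (j : Node c) :
      Desc (Node.root ω c r) (Node.under ω r j)
  | under (ω : ℕ+) {c : PForest} (r : PForest) {i j : Node c} :
      Desc i j → Desc (Node.under ω r i) (Node.under ω r j)
  | beside (ω : ℕ+) (c : PForest) {r : PForest} {i j : Node r} :
      Desc i j → Desc (Node.beside ω c i) (Node.beside ω c j)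

/-- The decoration of a node. -/
def dec : {F : PForest} → Node F → ℕ+
  | _, Node.root ω _ _ => ω
  | _, Node.under _ _ i => dec i
  | _, Node.beside _ _ i => dec i

def nodeEquiv (ω : ℕ+) (c r : PForest) : Unit ⊕ (Node c ⊕ Node r) ≃ Node (cons ω c r) where
  toFun
    | Sum.inl _ => Node.root ω c r
    | Sum.inr (Sum.inl i) => Node.under ω r i
    | Sum.inr (Sum.inr i) => Node.beside ω c i
  invFun
    | Node.root _ _ _ => Sum.inl ()
    | Node.under _ _ i => Sum.inr (Sum.inl i)
    | Node.beside _ _ i => Sum.inr (Sum.inr i)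
  left_inv x := by rcases x with _ | _ | _ <;> rfl
  right_inv x := by cases x <;> rfl

@[reducible]
def nodeFintype : (F : PForest) → Fintype (Node F)
  | nil => ⟨∅, fun x => nomatch x⟩
  | cons ω c r =>
    letI := nodeFintype c
    letI := nodeFintype r
    Fintype.ofEquiv _ (nodeEquiv ω c r)

instance (F : PForest) : Fintype (Node F) := nodeFintype F

end PForest

/-- Decorated (non-planar) forests: planar forests up to the order of siblings and of trees. -/
def Forest : Type := Quot PForest.Step

namespace Forest

/-- The forest underlying a planar forest. -/
def mk (F : PForest) : Forest := Quot.mk _ F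

/-- Adding to the forest `r` the tree with root `ω` and forest of children `c`. -/
def cons (ω : ℕ+) : Forest → Forest → Forest :=
  Quot.map₂ (PForest.cons ω) (fun c _ _ h => PForest.Step.rest ω c h)
    (fun _ _ r h => PForest.Step.child ω r h)

theorem step_append_left {F F' : PForest} (h : PForest.Step F F') (G : PForest) :
    PForest.Step (F.append G) (F'.append G) := by
  induction h with
  | swap => exact PForest.Step.swap _ _ _ _ _
  | child ω r h _ => exact PForest.Step.child ω _ h
  | rest ω c _ ih => exact PForest.Step.rest ω c ih

theorem step_append_right (F : PForest) {G G' : PForest} (h : PForest.Step G G') :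
    PForest.Step (F.append G) (F.append G') := by
  induction F with
  | nil => exact h
  | cons ω c r _ ih => exact PForest.Step.rest ω c ih

theorem append_assoc (F G K : PForest) :
    (F.append G).append K = F.append (G.append K) := by
  induction F with
  | nil => rfl
  | cons ω c r _ ih => simp only [PForest.append, ih]

theorem append_nil (F : PForest) : F.append PForest.nil = F := by
  induction F with
  | nil => rfl
  | cons ω c r _ ih => simp only [PForest.append, ih]

theorem mk_append_cons (ω : ℕ+) (c r G : PForest) :
    mk (G.append (PForest.cons ω c r)) = mk (PForest.cons ω c (G.append r)) := by
  induction G with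
  | nil => rfl
  | cons ω' c' r' _ ih =>
    have h1 : mk (PForest.cons ω' c' (r'.append (PForest.cons ω c r)))
        = mk (PForest.cons ω' c' (PForest.cons ω c (r'.append r))) :=
      congrArg (cons ω' (mk c')) ih
    exact h1.trans (Quot.sound (PForest.Step.swap _ _ _ _ _))

theorem mk_append_comm (F G : PForest) : mk (F.append G) = mk (G.append F) := by
  induction F with
  | nil => rw [append_nil]; rfl
  | cons ω c r _ ih =>
    rw [mk_append_cons]
    exact congrArg (cons ω (mk c)) ih

/-- The commutative monoid of decorated forests under disjoint union. -/
instance : CommMonoid Forest where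
  mul := Quot.map₂ PForest.append (fun F _ _ h => step_append_right F h)
    (fun _ _ G h => step_append_left h G)
  one := mk PForest.nil
  mul_assoc := by
    rintro ⟨F⟩ ⟨G⟩ ⟨K⟩
    exact congrArg mk (append_assoc F G K)
  one_mul := by
    rintro ⟨F⟩
    rfl
  mul_one := by
    rintro ⟨F⟩
    exact congrArg mk (append_nil F)
  mul_comm := by
    rintro ⟨F⟩ ⟨G⟩
    exact mk_append_comm F G

end Forest

/-- The Connes-Kreimer algebra of decorated forests (over the complex numbers). -/
abbrev Hck : Type := MonoidAlgebra ℂ Forest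

/-- The basis element of `Hck` given by a forest. -/
def Hck.of (F : PForest) : Hck := MonoidAlgebra.of ℂ Forest (Forest.mk F)

/-- The operator grafting all trees of a forest on a new root decorated by `ω`. -/
def Bplus (ω : ℕ+) : Hck →ₗ[ℂ] Hck :=
  MonoidAlgebra.mapDomainLinearMap ℂ ℂ (fun F : Forest => Forest.cons ω F 1)

/-- The linear span (over the complex numbers) of words with letters in the positive integers. -/
def Hqsh : Type := List ℕ+ →₀ ℂ

namespace Hqsh

instance : AddCommGroup Hqsh := inferInstanceAs (AddCommGroup (List ℕ+ →₀ ℂ))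

instance : Module ℂ Hqsh := inferInstanceAs (Module ℂ (List ℕ+ →₀ ℂ))

/-- A word, as a basis element. -/
def word (w : List ℕ+) : Hqsh := Finsupp.single w (1 : ℂ)

/-- The linear map with given values on words. -/
def lift {M : Type*} [AddCommGroup M] [Module ℂ M] (f : List ℕ+ → M) : Hqsh →ₗ[ℂ] M :=
  Finsupp.linearCombination ℂ f

theorem lift_word {M : Type*} [AddCommGroup M] [Module ℂ M] (f : List ℕ+ → M) (w : List ℕ+) :
    lift f (word w) = f w :=
  (Finsupp.linearCombination_single ℂ (1 : ℂ) w).trans (one_smul ℂ (f w))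

theorem hom_ext {M : Type*} [AddCommGroup M] [Module ℂ M] {φ ψ : Hqsh →ₗ[ℂ] M}
    (h : ∀ w, φ (word w) = ψ (word w)) : φ = ψ :=
  Finsupp.lhom_ext' (M := ℂ) fun w => LinearMap.ext_ring (h w)

/-- Concatenation of the letter `a` on the left. -/
def L (a : ℕ+) : Hqsh →ₗ[ℂ] Hqsh := lift fun w => word (a :: w)

/-- Reversal of words. -/
def rev : Hqsh →ₗ[ℂ] Hqsh := lift fun w => word w.reverse

/-- The quasi-shuffle product of two words. -/
def qshWord : List ℕ+ → List ℕ+ → Hqsh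
  | [], v => word v
  | a :: u, [] => word (a :: u)
  | a :: u, b :: v =>
    L a (qshWord u (b :: v)) + L b (qshWord (a :: u) v) + L (a + b) (qshWord u v)
termination_by u v => u.length + v.length

/-- The quasi-shuffle product, extended bilinearly. -/
def qsh : Hqsh →ₗ[ℂ] Hqsh →ₗ[ℂ] Hqsh := lift fun u => lift fun v => qshWord u v

theorem L_word (a : ℕ+) (w : List ℕ+) : L a (word w) = word (a :: w) := lift_word _ _

theorem qsh_word (u v : List ℕ+) : qsh (word u) (word v) = qshWord u v := by
  rw [qsh, lift_word, lift_word]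

theorem qshWord_nil (u : List ℕ+) : qshWord u [] = word u := by
  cases u <;> simp [qshWord]

theorem qsh_nil_left (x : Hqsh) : qsh (word []) x = x := by
  have : qsh (word []) = LinearMap.id := hom_ext fun w => by
    rw [qsh_word, qshWord]; rfl
  rw [this]; rfl

theorem qsh_nil_right (x : Hqsh) : qsh x (word []) = x := by
  have : qsh.flip (word []) = LinearMap.id := hom_ext fun w => by
    rw [LinearMap.flip_apply, qsh_word, qshWord_nil]; rfl
  exact congrArg (fun φ : Hqsh →ₗ[ℂ] Hqsh => φ x) this

theorem qsh_L_L (a b : ℕ+) (x y : Hqsh) :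
    qsh (L a x) (L b y) = L a (qsh x (L b y)) + L b (qsh (L a x) y) + L (a + b) (qsh x y) := by
  have h : qsh.compl₁₂ (L a) (L b) =
      (qsh.compl₁₂ LinearMap.id (L b)).compr₂ (L a) +
      (qsh.compl₁₂ (L a) LinearMap.id).compr₂ (L b) + qsh.compr₂ (L (a + b)) :=
    hom_ext fun u => hom_ext fun v => by
      simp only [LinearMap.compl₁₂_apply, LinearMap.add_apply, LinearMap.compr₂_apply,
        LinearMap.id_apply, L_word, qsh_word]
      rw [qshWord]
  exact congrArg (fun φ : Hqsh →ₗ[ℂ] Hqsh →ₗ[ℂ] Hqsh => φ x y) h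

theorem qshWord_comm (u v : List ℕ+) : qshWord u v = qshWord v u := by
  induction u, v using qshWord.induct with
  | case1 v => rw [qshWord_nil, qshWord]
  | case2 a u => rw [qshWord_nil, qshWord]
  | case3 a u b v h1 h2 h3 =>
    rw [qshWord, qshWord, h1, h2, h3, add_comm b a, add_comm (L a _) (L b _)]

theorem qsh_comm (x y : Hqsh) : qsh x y = qsh y x := by
  have h : qsh = qsh.flip := hom_ext fun u => hom_ext fun v => by
    rw [LinearMap.flip_apply, qsh_word, qsh_word, qshWord_comm]
  exact congrArg (fun φ : Hqsh →ₗ[ℂ] Hqsh →ₗ[ℂ] Hqsh => φ x y) h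

theorem qsh_assoc_word (n : ℕ) : ∀ u v w : List ℕ+, u.length + v.length + w.length ≤ n →
    qsh (qsh (word u) (word v)) (word w) = qsh (word u) (qsh (word v) (word w)) := by
  induction n with
  | zero =>
    intro u v w h
    have hu : u = [] := List.length_eq_zero_iff.mp (by omega)
    rw [hu, qsh_nil_left, qsh_nil_left]
  | succ n ih =>
    intro u v w h
    rcases u with _ | ⟨a, u⟩
    · rw [qsh_nil_left, qsh_nil_left]
    rcases v with _ | ⟨b, v⟩
    · rw [qsh_nil_right, qsh_nil_left]
    rcases w with _ | ⟨c, w⟩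
    · rw [qsh_nil_right, qsh_nil_right]
    simp only [List.length_cons] at h
    have i1 := ih u (b :: v) (c :: w) (by simp only [List.length_cons]; omega)
    have i2 := ih (a :: u) v (c :: w) (by simp only [List.length_cons]; omega)
    have i3 := ih (a :: u) (b :: v) w (by simp only [List.length_cons]; omega)
    have i4 := ih u v (c :: w) (by simp only [List.length_cons]; omega)
    have i5 := ih u (b :: v) w (by simp only [List.length_cons]; omega)
    have i6 := ih (a :: u) v w (by simp only [List.length_cons]; omega)
    have i7 := ih u v w (by omega)
    simp only [← L_word] at i1 i2 i3 i4 i5 i6 ⊢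
    generalize word u = x at *
    generalize word v = y at *
    generalize word w = z at *
    have e3 := congrArg (L c) i3
    rw [qsh_L_L a b] at e3
    simp only [map_add, LinearMap.add_apply] at e3
    have e1 := congrArg (L a) i1
    rw [qsh_L_L b c] at e1
    simp only [map_add] at e1
    rw [qsh_L_L a b, qsh_L_L b c]
    simp only [map_add, LinearMap.add_apply]
    rw [qsh_L_L a c, qsh_L_L b c, qsh_L_L (a + b) c, qsh_L_L a b, qsh_L_L a c, qsh_L_L a (b + c),
      e1, i2, i4, i5, i6, i7, ← add_assoc a b c]
    rw [← sub_eq_zero] at e3 ⊢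
    rw [← e3]
    abel

theorem qsh_assoc (x y z : Hqsh) : qsh (qsh x y) z = qsh x (qsh y z) := by
  have h1 : ∀ (x : Hqsh) (v w : List ℕ+),
      qsh (qsh x (word v)) (word w) = qsh x (qsh (word v) (word w)) := fun x v w =>
    congrArg (fun φ : Hqsh →ₗ[ℂ] Hqsh => φ x)
      (hom_ext (φ := qsh.flip (word w) ∘ₗ qsh.flip (word v))
        (ψ := qsh.flip (qsh (word v) (word w)))
        fun u => qsh_assoc_word _ u v w le_rfl)
  have h2 : ∀ (x y : Hqsh) (w : List ℕ+),
      qsh (qsh x y) (word w) = qsh x (qsh y (word w)) := fun x y w =>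
    congrArg (fun φ : Hqsh →ₗ[ℂ] Hqsh => φ y)
      (hom_ext (φ := qsh.flip (word w) ∘ₗ qsh x) (ψ := qsh x ∘ₗ qsh.flip (word w))
        fun v => h1 x v w)
  exact congrArg (fun φ : Hqsh →ₗ[ℂ] Hqsh => φ z)
    (hom_ext (φ := qsh (qsh x y)) (ψ := qsh x ∘ₗ qsh y) fun w => h2 x y w)

/-- The quasi-shuffle algebra; its unit is the empty word. -/
instance : CommRing Hqsh where
  __ := instAddCommGroup
  mul x y := qsh x y
  one := word []
  left_distrib x y z := map_add (qsh x) y z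
  right_distrib x y z := LinearMap.map_add₂ qsh x y z
  zero_mul x := LinearMap.map_zero₂ qsh x
  mul_zero x := map_zero (qsh x)
  mul_assoc := qsh_assoc
  one_mul := qsh_nil_left
  mul_one := qsh_nil_right
  mul_comm := qsh_comm

instance : Algebra ℂ Hqsh :=
  Algebra.ofModule (fun c x y => LinearMap.map_smul₂ qsh c x y) (fun c x y => map_smul (qsh x) c y)

end Hqsh

/-- The arborification morphism on planar forests. -/
def arborifyPlanar : PForest → Hqsh
  | PForest.nil => 1
  | PForest.cons ω c r => Hqsh.L ω (arborifyPlanar c) * arborifyPlanar r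

theorem arborifyPlanar_step {F G : PForest} (h : PForest.Step F G) :
    arborifyPlanar F = arborifyPlanar G := by
  induction h with
  | swap => simp only [arborifyPlanar]; ring
  | child ω r _ ih => simp only [arborifyPlanar, ih]
  | rest ω c _ ih => simp only [arborifyPlanar, ih]

theorem arborifyPlanar_append (F G : PForest) :
    arborifyPlanar (F.append G) = arborifyPlanar F * arborifyPlanar G := by
  induction F with
  | nil => exact (one_mul _).symm
  | cons ω c r _ ih => simp only [PForest.append, arborifyPlanar, ih, mul_assoc]

/-- The arborification morphism on forests. -/
def arborifyForest : Forest →* Hqsh where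
  toFun := Quot.lift arborifyPlanar fun _ _ h => arborifyPlanar_step h
  map_one' := rfl
  map_mul' := by
    rintro ⟨F⟩ ⟨G⟩
    exact arborifyPlanar_append F G

/-- The (contracting) arborification morphism. -/
def arborify : Hck →ₐ[ℂ] Hqsh := MonoidAlgebra.lift ℂ Hqsh Forest arborifyForest

theorem arborify_of (F : PForest) : arborify (Hck.of F) = arborifyPlanar F :=
  MonoidAlgebra.lift_of arborifyForest (Forest.mk F)

theorem Bplus_of (ω : ℕ+) (F : PForest) :
    Bplus ω (Hck.of F) = Hck.of (PForest.cons ω F PForest.nil) := by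
  simp only [Bplus, Hck.of, MonoidAlgebra.of_apply, MonoidAlgebra.mapDomainLinearMap_single]
  rfl

/-- Arborification intertwines grafting on a root and concatenation of a letter on the left. -/
theorem arborify_Bplus (ω : ℕ+) (x : Hck) : arborify (Bplus ω x) = Hqsh.L ω (arborify x) := by
  have h : arborify.toLinearMap ∘ₗ Bplus ω = Hqsh.L ω ∘ₗ arborify.toLinearMap := by
    ext ⟨F⟩
    have h1 : arborify (Bplus ω (Hck.of F)) = Hqsh.L ω (arborify (Hck.of F)) := by
      rw [Bplus_of, arborify_of, arborify_of, arborifyPlanar, arborifyPlanar, mul_one]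
    exact h1
  exact congrArg (fun φ : Hck →ₗ[ℂ] Hqsh => φ x) h

/-- Arborification is the only algebra morphism with this property. -/
theorem arborify_unique (α : Hck →ₐ[ℂ] Hqsh)
    (h : ∀ ω x, α (Bplus ω x) = Hqsh.L ω (α x)) : α = arborify := by
  have key : ∀ F : PForest, α (Hck.of F) = arborify (Hck.of F) := by
    intro F
    induction F with
    | nil => exact (map_one α).trans (map_one arborify).symm
    | cons ω c r h1 h2 =>
      have e : Hck.of (PForest.cons ω c r) = Bplus ω (Hck.of c) * Hck.of r := by
        rw [Bplus_of]
        exact map_mul (MonoidAlgebra.of ℂ Forest)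
          (Forest.mk (PForest.cons ω c PForest.nil)) (Forest.mk r)
      rw [e, map_mul, map_mul, h, arborify_Bplus, h1, h2]
  refine MonoidAlgebra.algHom_ext ?_ (by ext)
  rintro ⟨F⟩
  exact key F

section Atkinson

variable {A : Type*} [CommRing A] [Algebra ℂ A]

/-- The convolution product of linear maps for the deconcatenation coproduct. -/
def conv (φ ψ : Hqsh →ₗ[ℂ] A) : Hqsh →ₗ[ℂ] A :=
  Hqsh.lift fun w => ∑ k ∈ Finset.range (w.length + 1),
    φ (Hqsh.word (w.take k)) * ψ (Hqsh.word (w.drop k))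

/-- The unit of the convolution product. -/
def convUnit : Hqsh →ₗ[ℂ] A := Hqsh.lift fun w => if w = [] then 1 else 0

/-- The map sending the empty word to `1`, a letter `ω` to `γ ^ ω`, and longer words to `0`. -/
def letterMap (γ : A) : Hqsh →ₗ[ℂ] A := Hqsh.lift fun
  | [] => 1
  | [ω] => γ ^ (ω : ℕ)
  | _ => 0

/-- The iterates of the recursion `X ↦ R (X a)` for the convolution product. -/
def iterate (R : A →ₗ[ℂ] A) (a : Hqsh →ₗ[ℂ] A) : ℕ → (Hqsh →ₗ[ℂ] A)
  | 0 => convUnit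
  | n + 1 => R ∘ₗ conv (iterate R a n) a

/-- The Atkinson series `F = ∑ tⁿ (R a)^[n]`. On each word, only finitely many terms are non-zero
when `a` vanishes on the empty word. -/
def atkinson (R : A →ₗ[ℂ] A) (a : Hqsh →ₗ[ℂ] A) (t : ℂ) : Hqsh →ₗ[ℂ] A :=
  Hqsh.lift fun w => ∑ᶠ n : ℕ, t ^ n • iterate R a n (Hqsh.word w)

end Atkinson

/-- Bounded integrable functions on the line, continuous on both open half-lines. -/
def diffSpace : Submodule ℂ (ℝ → ℂ) where
  carrier := {f | (∃ C : ℝ, ∀ x, ‖f x‖ ≤ C) ∧ Integrable f ∧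
    ContinuousOn f (Set.Ioi 0) ∧ ContinuousOn f (Set.Iio 0)}
  zero_mem' := ⟨⟨0, fun _ => by simp⟩, integrable_zero _ _ _, continuousOn_const, continuousOn_const⟩
  add_mem' := by
    rintro f g ⟨⟨C, hC⟩, h1, h2, h3⟩ ⟨⟨D, hD⟩, k1, k2, k3⟩
    exact ⟨⟨C + D, fun x => (norm_add_le _ _).trans (add_le_add (hC x) (hD x))⟩, h1.add k1,
      h2.add k2, h3.add k3⟩
  smul_mem' := by
    rintro c f ⟨⟨C, hC⟩, h1, h2, h3⟩
    refine ⟨⟨‖c‖ * C, fun x => ?_⟩, h1.smul c, h2.const_smul c, h3.const_smul c⟩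
    rw [Pi.smul_apply, norm_smul]
    exact mul_le_mul_of_nonneg_left (hC x) (norm_nonneg c)

/-- The convolution of functions on the line. -/
def cv (f g : ℝ → ℂ) : ℝ → ℂ :=
  convolution f g (ContinuousLinearMap.mul ℂ ℂ) volume

theorem cv_comm (f g : ℝ → ℂ) : cv f g = cv g f := by
  have h : (ContinuousLinearMap.mul ℂ ℂ).flip = ContinuousLinearMap.mul ℂ ℂ := by
    ext; simp
  rw [cv, ← convolution_flip, h, cv]

theorem cv_exists {f g : ℝ → ℂ} (hf : f ∈ diffSpace) (hg : g ∈ diffSpace) :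
    ConvolutionExists f g (ContinuousLinearMap.mul ℂ ℂ) volume := by
  intro x
  obtain ⟨C, hC⟩ := hg.1
  have hm : AEStronglyMeasurable (fun t => g (x - t)) volume :=
    (hg.2.1.comp_sub_left x).aestronglyMeasurable
  exact hf.2.1.mul_bdd (c := C) hm (Filter.Eventually.of_forall fun t => hC _)

theorem continuousAt_of_mem {g : ℝ → ℂ} (hg : g ∈ diffSpace) {x : ℝ} (hx : x ≠ 0) :
    ContinuousAt g x := by
  rcases lt_or_gt_of_ne hx with h | h
  · exact hg.2.2.2.continuousAt (Iio_mem_nhds h)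
  · exact hg.2.2.1.continuousAt (Ioi_mem_nhds h)

theorem cv_continuous {f g : ℝ → ℂ} (hf : f ∈ diffSpace) (hg : g ∈ diffSpace) :
    Continuous (cv f g) := by
  obtain ⟨C, hC⟩ := hg.1
  refine continuous_iff_continuousAt.mpr fun x₀ => ?_
  refine continuousAt_of_dominated (bound := fun t => ‖f t‖ * C)
    (Filter.Eventually.of_forall fun x => (cv_exists hf hg x).aestronglyMeasurable)
    (Filter.Eventually.of_forall fun x => Filter.Eventually.of_forall fun t => ?_)
    (hf.2.1.norm.mul_const C) ?_
  · simp only [ContinuousLinearMap.mul_apply', norm_mul]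
    exact mul_le_mul_of_nonneg_left (hC _) (norm_nonneg _)
  · have h0 : ∀ᵐ t : ℝ, t ≠ x₀ := Measure.ae_ne volume x₀
    filter_upwards [h0] with t ht
    simp only [ContinuousLinearMap.mul_apply']
    refine continuousAt_const.mul ?_
    have h1 : ContinuousAt g (x₀ - t) := continuousAt_of_mem hg (sub_ne_zero.mpr ht.symm)
    exact ContinuousAt.comp (f := fun x => x - t) h1 (by fun_prop)

theorem cv_mem {f g : ℝ → ℂ} (hf : f ∈ diffSpace) (hg : g ∈ diffSpace) : cv f g ∈ diffSpace := by
  obtain ⟨C, hC⟩ := hg.1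
  have hcont := cv_continuous hf hg
  refine ⟨⟨∫ t, ‖f t‖ * C, fun x => ?_⟩,
    hf.2.1.integrable_convolution (ContinuousLinearMap.mul ℂ ℂ) hg.2.1,
    hcont.continuousOn, hcont.continuousOn⟩
  refine norm_integral_le_of_norm_le (hf.2.1.norm.mul_const C)
    (Filter.Eventually.of_forall fun t => ?_)
  simp only [ContinuousLinearMap.mul_apply', norm_mul]
  exact mul_le_mul_of_nonneg_left (hC _) (norm_nonneg _)

theorem cv_assoc {f g k : ℝ → ℂ} (hf : f ∈ diffSpace) (hg : g ∈ diffSpace) (hk : k ∈ diffSpace) :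
    cv (cv f g) k = cv f (cv g k) := by
  funext x
  obtain ⟨C, hC⟩ := hk.1
  have hb : ∀ y t, ‖‖g t‖ * ‖k (y - t)‖‖ ≤ ‖g t‖ * C := fun y t => by
    rw [norm_mul, norm_norm, norm_norm]
    exact mul_le_mul_of_nonneg_left (hC _) (norm_nonneg _)
  have hgk : ∀ y, ConvolutionExistsAt (fun x => ‖g x‖) (fun x => ‖k x‖) y
      (ContinuousLinearMap.mul ℝ ℝ) volume := fun y =>
    hg.2.1.norm.mul_bdd (c := C) (hk.2.1.norm.comp_sub_left y).aestronglyMeasurable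
      (Filter.Eventually.of_forall fun t => by rw [norm_norm]; exact hC _)
  refine convolution_assoc _ _ _ _ (fun a b c => mul_assoc a b c) hf.2.1.aestronglyMeasurable
    hg.2.1.aestronglyMeasurable hk.2.1.aestronglyMeasurable
    (Filter.Eventually.of_forall (cv_exists hf hg)) (Filter.Eventually.of_forall hgk) ?_
  have hi : Integrable (convolution (fun x => ‖g x‖) (fun x => ‖k x‖)
      (ContinuousLinearMap.mul ℝ ℝ) volume) volume :=
    hg.2.1.norm.integrable_convolution _ hk.2.1.norm
  exact hf.2.1.norm.mul_bdd (c := ∫ t, ‖g t‖ * C) (hi.comp_sub_left x).aestronglyMeasurable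
    (Filter.Eventually.of_forall fun t => norm_integral_le_of_norm_le (hg.2.1.norm.mul_const C)
      (Filter.Eventually.of_forall fun s => hb _ s))

theorem cv_add {f g k : ℝ → ℂ} (hf : f ∈ diffSpace) (hg : g ∈ diffSpace) (hk : k ∈ diffSpace) :
    cv f (g + k) = cv f g + cv f k :=
  (cv_exists hf hg).distrib_add (cv_exists hf hk)

/-- The space of functions, as a non-unital algebra for the convolution product. -/
instance : NonUnitalCommRing diffSpace where
  __ := diffSpace.addCommGroup
  mul f g := ⟨cv f g, cv_mem f.2 g.2⟩
  left_distrib f g k := Subtype.ext (cv_add f.2 g.2 k.2)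
  right_distrib f g k := Subtype.ext <| by
    change cv (f + g) k = cv f k + cv g k
    rw [cv_comm _ (k : ℝ → ℂ), cv_add k.2 f.2 g.2, cv_comm (k : ℝ → ℂ), cv_comm (k : ℝ → ℂ)]
  zero_mul f := Subtype.ext zero_convolution
  mul_zero f := Subtype.ext convolution_zero
  mul_assoc f g k := Subtype.ext (cv_assoc f.2 g.2 k.2)
  mul_comm f g := Subtype.ext (cv_comm f g)

instance : IsScalarTower ℂ diffSpace diffSpace where
  smul_assoc _ _ _ := Subtype.ext smul_convolution

instance : SMulCommClass ℂ diffSpace diffSpace where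
  smul_comm _ _ _ := Subtype.ext convolution_smul.symm

/-- The convolution algebra with a unit (the Dirac distribution at `0`) adjoined. -/
abbrev DiffAlg : Type := Unitization ℂ diffSpace

/-- The indicator function of the positive real numbers. -/
def sigmaPlus : ℝ → ℂ := Set.indicator (Set.Ioi 0) 1

theorem mul_sigmaPlus_mem {f : ℝ → ℂ} (hf : f ∈ diffSpace) : f * sigmaPlus ∈ diffSpace := by
  have h : f * sigmaPlus = Set.indicator (Set.Ioi 0) f := by
    funext x
    by_cases hx : x ∈ Set.Ioi (0 : ℝ) <;> simp [sigmaPlus, hx]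
  rw [h]
  obtain ⟨⟨C, hC⟩, h1, h2, _⟩ := hf
  refine ⟨⟨C, fun x => (norm_indicator_le_norm_self f x).trans (hC x)⟩,
    h1.indicator measurableSet_Ioi, h2.congr fun x hx => Set.indicator_of_mem hx f,
    (continuousOn_const (c := (0 : ℂ))).congr fun x hx => Set.indicator_of_notMem ?_ f⟩
  exact not_lt.mpr (le_of_lt (Set.mem_Iio.mp hx))

/-- Restriction of functions to the positive half-line. -/
def restrictPos : diffSpace →ₗ[ℂ] diffSpace where
  toFun f := ⟨f * sigmaPlus, mul_sigmaPlus_mem f.2⟩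
  map_add' f g := Subtype.ext (add_mul (f : ℝ → ℂ) g sigmaPlus)
  map_smul' c f := Subtype.ext (smul_mul_assoc c (f : ℝ → ℂ) sigmaPlus)

/-- The Rota-Baxter operator `f ↦ f σ₊`; it fixes the unit. -/
def rotaBaxter : DiffAlg →ₗ[ℂ] DiffAlg where
  toFun f := Unitization.inl f.fst + Unitization.inr (restrictPos f.snd)
  map_add' f g := by
    ext <;> simp
  map_smul' c f := by
    ext <;> simp

/-- The integral over the line, with value `1` on the unit. -/
def totalIntegral : DiffAlg →ₗ[ℂ] ℂ where
  toFun f := f.fst + ∫ x, (f.snd : ℝ → ℂ) x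
  map_add' f g := by
    have h := integral_add f.snd.2.2.1 g.snd.2.2.1
    simp only [Unitization.fst_add, Unitization.snd_add, Submodule.coe_add, Pi.add_apply]
    rw [h]; ring
  map_smul' c f := by
    simp only [Unitization.fst_smul, Unitization.snd_smul, Submodule.coe_smul, Pi.smul_apply,
      smul_eq_mul, RingHom.id_apply, integral_const_mul]
    ring

/-- The function `g_ω = exp (-ω β)`. -/
def gFun (β : ℝ → ℂ) (ω : ℕ+) (y : ℝ) : ℂ := Complex.exp (-(ω : ℂ) * β y)

/-- The Fourier transform `f_ω` of `g_ω`. -/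
def fFun (β : ℝ → ℂ) (ω : ℕ+) (x : ℝ) : ℂ :=
  1 / (2 * Real.pi) * ∫ y : ℝ, gFun β ω y * Complex.exp (Complex.I * x * y)

theorem gFun_continuous {β : ℝ → ℂ} (hβ : AnalyticOnNhd ℝ β Set.univ) (ω : ℕ+) :
    Continuous (gFun β ω) := by
  have h : Continuous β := continuousOn_univ.mp hβ.continuousOn
  unfold gFun
  fun_prop

theorem norm_exp_I_mul (x y : ℝ) : ‖Complex.exp (Complex.I * x * y)‖ = 1 := by
  have h : Complex.I * x * y = ((x * y : ℝ) : ℂ) * Complex.I := by push_cast; ring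
  rw [h, Complex.norm_exp_ofReal_mul_I]

theorem gFun_integrable {β : ℝ → ℂ} (hβ : AnalyticOnNhd ℝ β Set.univ) {ω : ℕ+}
    (h : ∫ x, ‖fFun β ω x‖ = 1) : Integrable (gFun β ω) := by
  by_contra hg
  have h0 : ∀ x, fFun β ω x = 0 := by
    intro x
    have h1 : ¬ Integrable fun y : ℝ => gFun β ω y * Complex.exp (Complex.I * x * y) := by
      intro h2
      apply hg
      refine h2.mono (gFun_continuous hβ ω).aestronglyMeasurable
        (Filter.Eventually.of_forall fun y => ?_)
      rw [norm_mul, norm_exp_I_mul, mul_one]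
    rw [fFun, integral_undef h1, mul_zero]
  simp [h0] at h

theorem fFun_mem {β : ℝ → ℂ} (hβ : AnalyticOnNhd ℝ β Set.univ) {ω : ℕ+}
    (h : ∫ x, ‖fFun β ω x‖ = 1) : fFun β ω ∈ diffSpace := by
  have hg := gFun_integrable hβ h
  have hgc := gFun_continuous hβ ω
  have hn : ∀ x y : ℝ, ‖gFun β ω y * Complex.exp (Complex.I * x * y)‖ ≤ ‖gFun β ω y‖ :=
    fun x y => by rw [norm_mul, norm_exp_I_mul, mul_one]
  have hc : Continuous (fFun β ω) := by
    refine continuous_const.mul (continuous_of_dominated (bound := fun y => ‖gFun β ω y‖)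
      (fun x => ?_) (fun x => Filter.Eventually.of_forall (hn x)) hg.norm
      (Filter.Eventually.of_forall fun y => by fun_prop))
    exact Continuous.aestronglyMeasurable (by fun_prop)
  have hi : Integrable (fFun β ω) := by
    by_contra hi
    have h1 : ¬ Integrable fun x => ‖fFun β ω x‖ := fun h2 =>
      hi ((integrable_norm_iff hc.aestronglyMeasurable).mp h2)
    rw [integral_undef h1] at h
    exact zero_ne_one h
  refine ⟨⟨‖(1 / (2 * Real.pi) : ℂ)‖ * ∫ y, ‖gFun β ω y‖, fun x => ?_⟩, hi, hc.continuousOn,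
    hc.continuousOn⟩
  rw [fFun, norm_mul]
  exact mul_le_mul_of_nonneg_left
    (norm_integral_le_of_norm_le hg.norm (Filter.Eventually.of_forall (hn x))) (norm_nonneg _)

/-- The element `γ = f_1` of the convolution algebra. -/
def gamma (β : ℝ → ℂ) (hβ : AnalyticOnNhd ℝ β Set.univ)
    (hf : ∀ ω : ℕ+, ∫ x, ‖fFun β ω x‖ = 1) : DiffAlg :=
  Unitization.inr ⟨fFun β 1, fFun_mem hβ (hf 1)⟩

/-- The series `F` at `t = -1`, for `a = I - e`; it satisfies `I = F⁻¹ G⁻¹`. -/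
def diffF (β : ℝ → ℂ) (hβ : AnalyticOnNhd ℝ β Set.univ)
    (hf : ∀ ω : ℕ+, ∫ x, ‖fFun β ω x‖ = 1) : Hqsh →ₗ[ℂ] DiffAlg :=
  atkinson rotaBaxter (letterMap (gamma β hβ hf) - convUnit) (-1)

/-- The diffusion character on the quasi-shuffle algebra. -/
def phiDiffusion (β : ℝ → ℂ) (hβ : AnalyticOnNhd ℝ β Set.univ)
    (hf : ∀ ω : ℕ+, ∫ x, ‖fFun β ω x‖ = 1) : Hqsh →ₗ[ℂ] ℂ :=
  totalIntegral ∘ₗ diffF β hβ hf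

/-- The antiarborified diffusion character on the Connes-Kreimer algebra. -/
def phiDiffusionAnti (β : ℝ → ℂ) (hβ : AnalyticOnNhd ℝ β Set.univ)
    (hf : ∀ ω : ℕ+, ∫ x, ‖fFun β ω x‖ = 1) : Hck →ₗ[ℂ] ℂ :=
  phiDiffusion β hβ hf ∘ₗ Hqsh.rev ∘ₗ arborify.toLinearMap

open Classical in
/-- The sum of the `x j` over the node `i` and all its descendants. -/
def hatSum {F : PForest} (x : PForest.Node F → ℝ) (i : PForest.Node F) : ℝ :=
  ∑ j with PForest.Desc i j, x j

end DiffusionAverage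

end

open MeasureTheory

noncomputable section

namespace DiffusionAverage

/-! ### The Atkinson series as a character of the quasi-shuffle algebra -/

section Atkinson

variable {A : Type*} [CommRing A] [Algebra ℂ A]

/-! Let Φ be the Atkinson series at t = -1 composed with the reversal of words. The recursion
handles the last letter of a word, so after reversal it handles the first: Φ(L_ω x) = -R(γ^ω Φ(x))
(`atkinsonRev_L`). Since R is a Rota-Baxter operator of weight -1 (`rotaBaxter_mul_rotaBaxter`), Φ
is multiplicative for the quasi-shuffle product (`atkinsonRev_mul`). Hence Φ∘α turns disjoint unions
into convolutions and grafting on a root ω into u ↦ -R(γ^ω u). Here γ^ω = f_ω, because the Fourier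
transform turns convolution into a product and g_a g_b = g_{a+b} (`gamma_pow`).

Now view an element of A as a complex measure on the line. A convolution is the image of a product
measure under addition, and on elements without a δ component R multiplies the density by σ₊. So, up
to the sign (-1)^r, Φ(α(F)) is the image of the measure ∏ f_{ω_i}(x_i) σ₊(x̂_i) dx under x ↦ ∑ x_i:
each grafting adds a variable and requires the sum over the whole new tree to be positive, which is
the factor of the root. This is proved by testing against all bounded measurable functions
(`pairing_atkinsonRev_arborifyPlanar`); the test function 1 gives Θ. -/

theorem letterMap_sub_convUnit_nil (γ : A) :
    (letterMap γ - convUnit : Hqsh →ₗ[ℂ] A) (Hqsh.word []) = 0 := by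
  simp [letterMap, convUnit, Hqsh.lift_word]

theorem letterMap_sub_convUnit_singleton (γ : A) (ω : ℕ+) :
    (letterMap γ - convUnit : Hqsh →ₗ[ℂ] A) (Hqsh.word [ω]) = γ ^ (ω : ℕ) := by
  simp [letterMap, convUnit, Hqsh.lift_word]

theorem letterMap_sub_convUnit_cons_cons (γ : A) (ω ω' : ℕ+) (w : List ℕ+) :
    (letterMap γ - convUnit : Hqsh →ₗ[ℂ] A) (Hqsh.word (ω :: ω' :: w)) = 0 := by
  simp [letterMap, convUnit, Hqsh.lift_word]

theorem conv_letterMap_nil (φ : Hqsh →ₗ[ℂ] A) (γ : A) :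
    conv φ (letterMap γ - convUnit) (Hqsh.word []) = 0 := by
  rw [conv, Hqsh.lift_word]
  simp only [List.length_nil, zero_add, Finset.sum_range_one, List.drop_nil,
    letterMap_sub_convUnit_nil, mul_zero]

/-- The right factor lives on one-letter words, so among all deconcatenations only the one cutting
off the last letter survives. -/
theorem conv_letterMap_concat (φ : Hqsh →ₗ[ℂ] A) (γ : A) (u : List ℕ+) (ω : ℕ+) :
    conv φ (letterMap γ - convUnit) (Hqsh.word (u ++ [ω]))
      = φ (Hqsh.word u) * γ ^ (ω : ℕ) := by
  rw [conv, Hqsh.lift_word, Finset.sum_eq_single u.length]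
  · rw [List.take_left, List.drop_left, letterMap_sub_convUnit_singleton]
  · intro k hk hku
    have hd := List.length_drop (l := u ++ [ω]) (i := k)
    rw [List.length_append, List.length_singleton] at hd
    rw [Finset.mem_range, List.length_append, List.length_singleton] at hk
    rcases h : (u ++ [ω]).drop k with _ | ⟨a, _ | ⟨b, v⟩⟩
    · rw [letterMap_sub_convUnit_nil, mul_zero]
    · rw [h, List.length_singleton] at hd
      omega
    · rw [letterMap_sub_convUnit_cons_cons, mul_zero]
  · intro h
    simp at h

/-- Each iteration consumes exactly one letter. The series therefore has a single non-zero term on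
each word, the one indexed by its length. -/
theorem iterate_eq_zero (R : A →ₗ[ℂ] A) (γ : A) (n : ℕ) : ∀ w : List ℕ+, w.length ≠ n →
    iterate R (letterMap γ - convUnit) n (Hqsh.word w) = 0 := by
  induction n with
  | zero =>
    intro w hw
    have : w ≠ [] := fun h => hw (by rw [h]; rfl)
    simp [iterate, convUnit, Hqsh.lift_word, this]
  | succ n ih =>
    intro w hw
    rw [iterate, LinearMap.comp_apply]
    rcases List.eq_nil_or_concat w with rfl | ⟨u, ω, rfl⟩
    · rw [conv_letterMap_nil, map_zero]
    · rw [List.concat_eq_append, conv_letterMap_concat, ih, zero_mul, map_zero]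
      simpa using hw

theorem atkinson_letterMap_word (R : A →ₗ[ℂ] A) (γ : A) (t : ℂ) (w : List ℕ+) :
    atkinson R (letterMap γ - convUnit) t (Hqsh.word w)
      = t ^ w.length • iterate R (letterMap γ - convUnit) w.length (Hqsh.word w) := by
  rw [atkinson, Hqsh.lift_word]
  refine finsum_eq_single _ _ fun n hn => ?_
  rw [iterate_eq_zero R γ n w hn.symm, smul_zero]

theorem atkinson_letterMap_nil (R : A →ₗ[ℂ] A) (γ : A) (t : ℂ) :
    atkinson R (letterMap γ - convUnit) t (Hqsh.word []) = 1 := by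
  rw [atkinson_letterMap_word]
  simp [iterate, convUnit, Hqsh.lift_word]

theorem atkinson_letterMap_concat (R : A →ₗ[ℂ] A) (γ : A) (t : ℂ) (u : List ℕ+) (ω : ℕ+) :
    atkinson R (letterMap γ - convUnit) t (Hqsh.word (u ++ [ω]))
      = t • R (atkinson R (letterMap γ - convUnit) t (Hqsh.word u) * γ ^ (ω : ℕ)) := by
  rw [atkinson_letterMap_word, atkinson_letterMap_word, List.length_append, List.length_singleton,
    iterate, LinearMap.comp_apply, conv_letterMap_concat, smul_mul_assoc, map_smul, pow_succ',
    mul_smul]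

/-- The Atkinson series precomposed with the reversal of words. -/
def atkinsonRev (R : A →ₗ[ℂ] A) (γ : A) (t : ℂ) : Hqsh →ₗ[ℂ] A :=
  atkinson R (letterMap γ - convUnit) t ∘ₗ Hqsh.rev

theorem atkinsonRev_nil (R : A →ₗ[ℂ] A) (γ : A) (t : ℂ) :
    atkinsonRev R γ t (Hqsh.word []) = 1 := by
  rw [atkinsonRev, LinearMap.comp_apply, Hqsh.rev, Hqsh.lift_word, List.reverse_nil,
    atkinson_letterMap_nil]

theorem atkinsonRev_L (R : A →ₗ[ℂ] A) (γ : A) (t : ℂ) (ω : ℕ+) (x : Hqsh) :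
    atkinsonRev R γ t (Hqsh.L ω x) = t • R (γ ^ (ω : ℕ) * atkinsonRev R γ t x) := by
  have h : atkinsonRev R γ t ∘ₗ Hqsh.L ω
      = t • R ∘ₗ LinearMap.mulLeft ℂ (γ ^ (ω : ℕ)) ∘ₗ atkinsonRev R γ t :=
    Hqsh.hom_ext fun w => by
      simp only [LinearMap.comp_apply, LinearMap.smul_apply, LinearMap.mulLeft_apply, Hqsh.L_word]
      simp only [atkinsonRev, LinearMap.comp_apply, Hqsh.rev, Hqsh.lift_word, List.reverse_cons]
      rw [atkinson_letterMap_concat, mul_comm]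
  exact congrArg (fun φ : Hqsh →ₗ[ℂ] A => φ x) h

/-- If `R` is a Rota-Baxter operator of weight `-1`, the reversed series at `-1` is a character. -/
theorem atkinsonRev_mul_word {R : A →ₗ[ℂ] A}
    (hR : ∀ f g, R f * R g + R (f * g) = R (R f * g) + R (f * R g)) (γ : A) (u v : List ℕ+) :
    atkinsonRev R γ (-1) (Hqsh.qshWord u v)
      = atkinsonRev R γ (-1) (Hqsh.word u) * atkinsonRev R γ (-1) (Hqsh.word v) := by
  induction u, v using Hqsh.qshWord.induct with
  | case1 v => rw [Hqsh.qshWord, atkinsonRev_nil, one_mul]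
  | case2 a u => rw [Hqsh.qshWord_nil, atkinsonRev_nil, mul_one]
  | case3 a u b v h1 h2 h3 =>
    rw [Hqsh.qshWord, map_add, map_add, atkinsonRev_L, atkinsonRev_L, atkinsonRev_L, h1, h2, h3,
      ← Hqsh.L_word a, ← Hqsh.L_word b, atkinsonRev_L, atkinsonRev_L]
    generalize atkinsonRev R γ (-1) (Hqsh.word u) = x
    generalize atkinsonRev R γ (-1) (Hqsh.word v) = y
    -- With P and Q the two arguments of `hR`, the terms led by `a` and by `b` give R(P R(Q)) +
    -- R(R(P) Q), two signs cancelling in each, and the contracted term gives -R(PQ). This is the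
    -- Rota-Baxter expression of R(P)R(Q).
    have h := hR (γ ^ (a : ℕ) * x) (γ ^ (b : ℕ) * y)
    have e1 : γ ^ (a : ℕ) * (x * R (γ ^ (b : ℕ) * y)) = γ ^ (a : ℕ) * x * R (γ ^ (b : ℕ) * y) := by
      ring
    have e2 : γ ^ (b : ℕ) * (R (γ ^ (a : ℕ) * x) * y) = R (γ ^ (a : ℕ) * x) * (γ ^ (b : ℕ) * y) := by
      ring
    have e3 : γ ^ ((a + b : ℕ+) : ℕ) * (x * y) = γ ^ (a : ℕ) * x * (γ ^ (b : ℕ) * y) := by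
      rw [PNat.add_coe, pow_add]
      ring
    simp only [neg_smul, one_smul, neg_mul, mul_neg, map_neg, neg_neg, e1, e2, e3]
    linear_combination -h

theorem atkinsonRev_mul {R : A →ₗ[ℂ] A}
    (hR : ∀ f g, R f * R g + R (f * g) = R (R f * g) + R (f * R g)) (γ : A) (x y : Hqsh) :
    atkinsonRev R γ (-1) (x * y) = atkinsonRev R γ (-1) x * atkinsonRev R γ (-1) y := by
  have h : Hqsh.qsh.compr₂ (atkinsonRev R γ (-1))
      = (LinearMap.mul ℂ A).compl₁₂ (atkinsonRev R γ (-1)) (atkinsonRev R γ (-1)) :=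
    Hqsh.hom_ext fun u => Hqsh.hom_ext fun v => by
      simp only [LinearMap.compr₂_apply, LinearMap.compl₁₂_apply, LinearMap.mul_apply',
        Hqsh.qsh_word, atkinsonRev_mul_word hR]
  exact congrArg (fun φ : Hqsh →ₗ[ℂ] Hqsh →ₗ[ℂ] A => φ x y) h

end Atkinson

/-! ### The Rota-Baxter identity for restriction to the positive half-line -/

/-- If t + (x - t) is positive, one of the two summands is positive: functions supported on a
half-line are stable under convolution. -/
theorem cv_eq_zero_of_pos {f g : ℝ → ℂ} (hf : ∀ x, 0 < x → f x = 0) (hg : ∀ x, 0 < x → g x = 0)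
    {x : ℝ} (hx : 0 < x) : cv f g x = 0 := by
  refine (integral_congr_ae (Filter.Eventually.of_forall fun t => ?_)).trans (integral_zero _ _)
  rcases lt_or_ge 0 t with h | h
  · simp [hf t h]
  · simp [hg (x - t) (by linarith)]

theorem cv_eq_zero_of_nonpos {f g : ℝ → ℂ} (hf : ∀ x, x ≤ 0 → f x = 0)
    (hg : ∀ x, x ≤ 0 → g x = 0) {x : ℝ} (hx : x ≤ 0) : cv f g x = 0 := by
  refine (integral_congr_ae (Filter.Eventually.of_forall fun t => ?_)).trans (integral_zero _ _)
  rcases le_or_gt t 0 with h | h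
  · simp [hf t h]
  · simp [hg (x - t) (by linarith)]

theorem restrictPos_apply_of_pos (f : diffSpace) {x : ℝ} (hx : 0 < x) :
    (restrictPos f : ℝ → ℂ) x = (f : ℝ → ℂ) x := by
  change (f : ℝ → ℂ) x * sigmaPlus x = _
  simp [sigmaPlus, hx]

theorem restrictPos_apply_of_nonpos (f : diffSpace) {x : ℝ} (hx : x ≤ 0) :
    (restrictPos f : ℝ → ℂ) x = 0 := by
  change (f : ℝ → ℂ) x * sigmaPlus x = _
  simp [sigmaPlus, hx]

/-- The operator is the projection onto one subalgebra along a complementary one. Thus (f - Rf)(g -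
Rg) is killed by R while Rf·Rg is fixed, and expanding the former gives the identity. -/
theorem restrictPos_mul_restrictPos (f g : diffSpace) :
    restrictPos f * restrictPos g
      = restrictPos (restrictPos f * g) + restrictPos (f * restrictPos g)
        - restrictPos (f * g) := by
  have h1 : restrictPos (restrictPos f * restrictPos g) = restrictPos f * restrictPos g := by
    ext x
    rcases lt_or_ge 0 x with hx | hx
    · rw [restrictPos_apply_of_pos _ hx]
    · rw [restrictPos_apply_of_nonpos _ hx]
      exact (cv_eq_zero_of_nonpos (fun _ => restrictPos_apply_of_nonpos f)
        (fun _ => restrictPos_apply_of_nonpos g) hx).symm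
  have h2 : restrictPos ((f - restrictPos f) * (g - restrictPos g)) = 0 := by
    ext x
    rcases lt_or_ge 0 x with hx | hx
    · rw [restrictPos_apply_of_pos _ hx]
      refine cv_eq_zero_of_pos (fun y hy => ?_) (fun y hy => ?_) hx
      · exact sub_eq_zero.mpr (restrictPos_apply_of_pos f hy).symm
      · exact sub_eq_zero.mpr (restrictPos_apply_of_pos g hy).symm
    · rw [restrictPos_apply_of_nonpos _ hx]
      rfl
  rw [sub_mul, mul_sub, mul_sub, map_sub, map_sub, map_sub, h1] at h2
  rw [← sub_eq_zero, ← h2]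
  abel

/-- The scalar parts add cross terms such as a·R(R(g)), which match because R is idempotent. -/
theorem rotaBaxter_mul_rotaBaxter (f g : DiffAlg) :
    rotaBaxter f * rotaBaxter g + rotaBaxter (f * g)
      = rotaBaxter (rotaBaxter f * g) + rotaBaxter (f * rotaBaxter g) := by
  have hfst : ∀ x, (rotaBaxter x).fst = x.fst := fun x => add_zero _
  have hsnd : ∀ x, (rotaBaxter x).snd = restrictPos x.snd := fun x => zero_add _
  have hidem : ∀ f, restrictPos (restrictPos f) = restrictPos f := fun f => by
    ext x
    rcases lt_or_ge 0 x with hx | hx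
    · rw [restrictPos_apply_of_pos _ hx]
    · rw [restrictPos_apply_of_nonpos _ hx, restrictPos_apply_of_nonpos _ hx]
  refine Unitization.ext ?_ ?_
  · simp only [Unitization.fst_add, Unitization.fst_mul, hfst]
  · simp only [Unitization.snd_add, Unitization.snd_mul, hfst, hsnd, map_add, map_smul,
      restrictPos_mul_restrictPos, hidem]
    abel

/-! ### Powers of γ through Fourier inversion -/

open scoped FourierTransform in
theorem fFun_eq_fourierInv (β : ℝ → ℂ) (ω : ℕ+) :
    fFun β ω = 𝓕⁻ fun u : ℝ => gFun β ω (2 * Real.pi * u) := by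
  funext x
  have h := Measure.integral_comp_mul_left
    (fun y : ℝ => gFun β ω y * Complex.exp (Complex.I * x * y)) (2 * Real.pi)
  rw [abs_of_pos (by positivity)] at h
  rw [fFun, Real.fourierInv_eq']
  have e : (1 / (2 * Real.pi) : ℂ) = (((2 * Real.pi)⁻¹ : ℝ) : ℂ) := by push_cast; ring
  rw [e, ← Complex.real_smul, ← h]
  refine integral_congr_ae (Filter.Eventually.of_forall fun u => ?_)
  simp only [smul_eq_mul, RCLike.inner_apply, conj_trivial]
  rw [mul_comm]
  congr 2
  push_cast
  ring

open scoped FourierTransform in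
theorem fourier_fFun {β : ℝ → ℂ} (hβ : AnalyticOnNhd ℝ β Set.univ) {ω : ℕ+}
    (h : ∫ x, ‖fFun β ω x‖ = 1) :
    𝓕 (fFun β ω) = fun u : ℝ => gFun β ω (2 * Real.pi * u) := by
  have hi : Integrable fun u : ℝ => gFun β ω (2 * Real.pi * u) :=
    (gFun_integrable hβ h).comp_mul_left' (by positivity)
  have hc : Continuous fun u : ℝ => gFun β ω (2 * Real.pi * u) :=
    (gFun_continuous hβ ω).comp (by fun_prop)
  -- Inversion needs this transform to be integrable. It is `fFun β ω` reflected, whose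
  -- integrability comes from the normalisation of its L¹ norm.
  have hF : Integrable (𝓕 fun u : ℝ => gFun β ω (2 * Real.pi * u)) := by
    refine ((fFun_mem hβ h).2.1.comp_neg).congr (Filter.Eventually.of_forall fun v => ?_)
    change fFun β ω (-v) = _
    rw [fFun_eq_fourierInv, Real.fourierInv_eq_fourier_neg, neg_neg]
  rw [fFun_eq_fourierInv]
  exact hc.fourier_fourierInv_eq hi hF

-- The transforms agree because g_a g_b = g_{a+b}. The convolution is continuous and integrable with
-- an integrable transform, so inversion recovers it at every point.
open scoped FourierTransform in
theorem cv_fFun {β : ℝ → ℂ} (hβ : AnalyticOnNhd ℝ β Set.univ)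
    (hf : ∀ ω : ℕ+, ∫ x, ‖fFun β ω x‖ = 1) (a b : ℕ+) :
    cv (fFun β a) (fFun β b) = fFun β (a + b) := by
  have ha := fFun_mem hβ (hf a)
  have hb := fFun_mem hβ (hf b)
  have hF : 𝓕 (cv (fFun β a) (fFun β b)) = fun u : ℝ => gFun β (a + b) (2 * Real.pi * u) := by
    funext u
    have h1 : 𝓕 (cv (fFun β a) (fFun β b)) u = 𝓕 (fFun β a) u * 𝓕 (fFun β b) u :=
      Real.fourier_mul_convolution_eq ha.2.1 hb.2.1 u
    rw [h1, fourier_fFun hβ (hf a), fourier_fFun hβ (hf b)]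
    simp only [gFun, ← Complex.exp_add]
    congr 1
    push_cast
    ring
  rw [← (cv_continuous ha hb).fourierInv_fourier_eq (cv_mem ha hb).2.1, hF, ← fFun_eq_fourierInv]
  rw [hF]
  exact (gFun_integrable hβ (hf (a + b))).comp_mul_left' (by positivity)

theorem gamma_pow {β : ℝ → ℂ} (hβ : AnalyticOnNhd ℝ β Set.univ)
    (hf : ∀ ω : ℕ+, ∫ x, ‖fFun β ω x‖ = 1) (ω : ℕ+) :
    gamma β hβ hf ^ (ω : ℕ)
      = Unitization.inr (⟨fFun β ω, fFun_mem hβ (hf ω)⟩ : diffSpace) := by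
  induction ω using PNat.recOn with
  | one => exact pow_one _
  | succ ω ih =>
    rw [PNat.add_coe, PNat.one_coe, pow_succ, ih, gamma, ← Unitization.inr_mul]
    exact congrArg Unitization.inr (Subtype.ext (cv_fFun hβ hf ω 1))

/-! ### Elements of the convolution algebra as measures -/

/-- Bounded measurable functions on the line. -/
def BddMeas (h : ℝ → ℂ) : Prop := Measurable h ∧ ∃ C : ℝ, ∀ x, ‖h x‖ ≤ C

theorem BddMeas.comp_add {h : ℝ → ℂ} (hh : BddMeas h) (s : ℝ) : BddMeas fun x => h (s + x) :=
  ⟨hh.1.comp (measurable_const_add s), hh.2.imp fun _ hC _ => hC _⟩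

theorem BddMeas.integrable_mul {h : ℝ → ℂ} (hh : BddMeas h) {α : Type*} [MeasurableSpace α]
    {μ : Measure α} {f : α → ℂ} (hf : Integrable f μ) {k : α → ℝ} (hk : Measurable k) :
    Integrable (fun x => f x * h (k x)) μ := by
  obtain ⟨hm, C, hC⟩ := hh
  exact hf.mul_bdd (c := C) (hm.comp hk).aestronglyMeasurable
    (Filter.Eventually.of_forall fun x => hC _)

/-- The pairing of an element of the convolution algebra, seen as a measure, with a function. -/
def pairing (u : DiffAlg) (h : ℝ → ℂ) : ℂ := u.fst * h 0 + ∫ x, (u.snd : ℝ → ℂ) x * h x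

theorem pairing_one_right (u : DiffAlg) : pairing u 1 = totalIntegral u := by
  simp [pairing, totalIntegral]

theorem pairing_one_left (h : ℝ → ℂ) : pairing 1 h = h 0 := by
  simp [pairing]

theorem pairing_neg (u : DiffAlg) (h : ℝ → ℂ) : pairing (-u) h = -pairing u h := by
  simp [pairing, integral_neg]
  ring

theorem pairing_inr (f : diffSpace) (h : ℝ → ℂ) :
    pairing (Unitization.inr f) h = ∫ x, (f : ℝ → ℂ) x * h x := by
  simp [pairing]

/-- The factor from A₀ removes the δ component. This matters, since R fixes δ whereas multiplication
by σ₊ would kill it: σ₊(0) = 0. -/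
theorem pairing_rotaBaxter_inr_mul (f : diffSpace) (v : DiffAlg) (h : ℝ → ℂ) :
    pairing (rotaBaxter (Unitization.inr f * v)) h
      = pairing (Unitization.inr f * v) (sigmaPlus * h) := by
  have h0 : (Unitization.inr f * v : DiffAlg).fst = 0 := by simp
  have h1 : (rotaBaxter (Unitization.inr f * v)).fst = 0 := (add_zero _).trans h0
  have h2 : (rotaBaxter (Unitization.inr f * v)).snd
      = restrictPos (Unitization.inr f * v : DiffAlg).snd := zero_add _
  rw [pairing, pairing, h0, h1, h2]
  congr 1
  · rw [zero_mul, zero_mul]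
  · exact integral_congr_ae (Filter.Eventually.of_forall fun x => mul_assoc _ _ _)

/-- Makes the inner pairing of `pairing_mul` an admissible test function, so that pairings can be
iterated. -/
theorem BddMeas.pairing_comp_add {h : ℝ → ℂ} (hh : BddMeas h) (u : DiffAlg) :
    BddMeas fun s => pairing u fun x => h (s + x) := by
  obtain ⟨hm, C, hC⟩ := hh
  have hi := u.snd.2.2.1
  refine ⟨?_, ‖u.fst‖ * C + ∫ x, ‖(u.snd : ℝ → ℂ) x‖ * C, fun s => ?_⟩
  · have e : (fun s => pairing u fun x => h (s + x)) = fun s =>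
        u.fst * h (s + 0) + ∫ x, hi.aestronglyMeasurable.mk _ x * h (s + x) := by
      funext s
      rw [pairing]
      congr 1
      refine integral_congr_ae ?_
      filter_upwards [hi.aestronglyMeasurable.ae_eq_mk] with x hx
      rw [hx]
    rw [e]
    refine (measurable_const.mul (hm.comp (measurable_add_const 0))).add ?_
    have hs : StronglyMeasurable (Function.uncurry fun s x : ℝ =>
        hi.aestronglyMeasurable.mk _ x * h (s + x)) := by
      refine Measurable.stronglyMeasurable ?_
      exact (hi.aestronglyMeasurable.stronglyMeasurable_mk.measurable.comp measurable_snd).mul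
        (hm.comp (measurable_fst.add measurable_snd))
    exact hs.integral_prod_right.measurable
  · refine (norm_add_le _ _).trans (add_le_add ?_ ?_)
    · rw [norm_mul]
      exact mul_le_mul_of_nonneg_left (hC _) (norm_nonneg _)
    · refine norm_integral_le_of_norm_le (hi.norm.mul_const C)
        (Filter.Eventually.of_forall fun x => ?_)
      rw [norm_mul]
      exact mul_le_mul_of_nonneg_left (hC _) (norm_nonneg _)

/-- Fubini, then the translation x = s + y in the inner integral. -/
theorem integral_cv_mul {f g h : ℝ → ℂ} (hf : Integrable f) (hg : Integrable g) (hh : BddMeas h) :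
    ∫ x, cv f g x * h x = ∫ s, f s * ∫ y, g y * h (s + y) := by
  have hi : Integrable (Function.uncurry fun x t => f t * g (x - t) * h x)
      (volume.prod volume) :=
    hh.integrable_mul (hf.convolution_integrand (ContinuousLinearMap.mul ℂ ℂ) hg) measurable_fst
  calc ∫ x, cv f g x * h x = ∫ x, ∫ t, f t * g (x - t) * h x := by
        simp only [integral_mul_const]
        rfl
    _ = ∫ t, ∫ x, f t * g (x - t) * h x := integral_integral_swap hi
    _ = ∫ s, f s * ∫ y, g y * h (s + y) := by
        congr 1
        funext s
        rw [← integral_const_mul, ← integral_add_left_eq_self _ s]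
        simp only [add_sub_cancel_left, mul_assoc]

theorem pairing_mul (u v : DiffAlg) {h : ℝ → ℂ} (hh : BddMeas h) :
    pairing (u * v) h = pairing u fun s => pairing v fun y => h (s + y) := by
  have hu := u.snd.2.2.1
  have hv := v.snd.2.2.1
  have hcv := integral_cv_mul hu hv hh
  have i1 : Integrable fun x => (u.snd : ℝ → ℂ) x * h x := hh.integrable_mul hu measurable_id
  have i2 : Integrable fun x => (v.snd : ℝ → ℂ) x * h x := hh.integrable_mul hv measurable_id
  have i3 : Integrable fun x => cv u.snd v.snd x * h x :=
    hh.integrable_mul (cv_mem u.snd.2 v.snd.2).2.1 measurable_id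
  have i4 : Integrable fun s => (u.snd : ℝ → ℂ) s * ∫ y, (v.snd : ℝ → ℂ) y * h (s + y) := by
    have h4 := (hh.pairing_comp_add (Unitization.inr v.snd)).integrable_mul hu measurable_id
    simpa only [pairing_inr, id] using h4
  have e : (fun x => ((u * v).snd : ℝ → ℂ) x * h x) = fun x => u.fst * ((v.snd : ℝ → ℂ) x * h x)
      + (v.fst * ((u.snd : ℝ → ℂ) x * h x) + cv u.snd v.snd x * h x) := by
    funext x
    have : ((u * v).snd : ℝ → ℂ) x = u.fst * (v.snd : ℝ → ℂ) x + v.fst * (u.snd : ℝ → ℂ) x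
      + cv u.snd v.snd x := rfl
    rw [this]
    ring
  have e' : (fun s => (u.snd : ℝ → ℂ) s * (v.fst * h s + ∫ y, (v.snd : ℝ → ℂ) y * h (s + y)))
      = fun s => v.fst * ((u.snd : ℝ → ℂ) s * h s)
        + (u.snd : ℝ → ℂ) s * ∫ y, (v.snd : ℝ → ℂ) y * h (s + y) := by
    funext s
    ring
  have j1 := i1.const_mul v.fst
  have j2 := i2.const_mul u.fst
  have j13 : Integrable fun x => v.fst * ((u.snd : ℝ → ℂ) x * h x) + cv u.snd v.snd x * h x :=
    j1.add i3
  simp only [pairing, zero_add, add_zero]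
  rw [e, e', integral_add j2 j13, integral_add j1 i3, integral_add j1 i4,
    integral_const_mul, integral_const_mul, hcv, Unitization.fst_mul]
  ring

/-! ### Densities on forests and their recursion -/

open PForest

theorem sum_node_cons {M : Type*} [AddCommMonoid M] (ω : ℕ+) (c r : PForest)
    (f : Node (cons ω c r) → M) :
    ∑ i, f i = f (Node.root ω c r) + (∑ i, f (Node.under ω r i) + ∑ i, f (Node.beside ω c i)) := by
  rw [← Equiv.sum_comp (nodeEquiv ω c r), Fintype.sum_sum_type, Fintype.sum_sum_type,
    Fintype.sum_unique]
  rfl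

theorem prod_node_cons {M : Type*} [CommMonoid M] (ω : ℕ+) (c r : PForest)
    (f : Node (cons ω c r) → M) :
    ∏ i, f i = f (Node.root ω c r) * ((∏ i, f (Node.under ω r i)) * ∏ i, f (Node.beside ω c i)) := by
  rw [← Equiv.prod_comp (nodeEquiv ω c r), Fintype.prod_sum_type, Fintype.prod_sum_type,
    Fintype.prod_unique]
  rfl

theorem card_node_cons (ω : ℕ+) (c r : PForest) :
    Fintype.card (Node (cons ω c r)) = 1 + (Fintype.card (Node c) + Fintype.card (Node r)) := by
  rw [Fintype.card_congr (nodeEquiv ω c r).symm, Fintype.card_sum, Fintype.card_sum,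
    Fintype.card_unit]

section hatSum

variable (ω : ℕ+) {c r : PForest} (x : Node (cons ω c r) → ℝ)

/-- The descendants of the first root are the nodes of its own tree; the trees beside it do not
enter. -/
theorem hatSum_root :
    hatSum x (Node.root ω c r) = x (Node.root ω c r) + ∑ j, x (Node.under ω r j) := by
  classical
  have h : ∀ j : Node r, ¬ Desc (Node.root ω c r) (Node.beside ω c j) := fun j hj => by cases hj
  simp [hatSum, Finset.sum_filter, sum_node_cons, Desc.root_root, Desc.root_below, h]

theorem hatSum_under (i : Node c) :
    hatSum x (Node.under ω r i) = hatSum (fun j => x (Node.under ω r j)) i := by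
  classical
  have h0 : ¬ Desc (Node.under ω r i) (Node.root ω c r) := fun hj => by cases hj
  have h1 : ∀ j, Desc (Node.under ω r i) (Node.under ω r j) ↔ Desc i j := fun j =>
    ⟨fun hj => by cases hj; assumption, Desc.under ω r⟩
  have h2 : ∀ j : Node r, ¬ Desc (Node.under ω r i) (Node.beside ω c j) := fun j hj => by cases hj
  simp [hatSum, Finset.sum_filter, sum_node_cons, h0, h1, h2]

theorem hatSum_beside (i : Node r) :
    hatSum x (Node.beside ω c i) = hatSum (fun j => x (Node.beside ω c j)) i := by
  classical
  have h0 : ¬ Desc (Node.beside ω c i) (Node.root ω c r) := fun hj => by cases hj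
  have h1 : ∀ j, Desc (Node.beside ω c i) (Node.beside ω c j) ↔ Desc i j := fun j =>
    ⟨fun hj => by cases hj; assumption, Desc.beside ω c⟩
  have h2 : ∀ j : Node c, ¬ Desc (Node.beside ω c i) (Node.under ω r j) := fun j hj => by cases hj
  simp [hatSum, Finset.sum_filter, sum_node_cons, h0, h1, h2]

end hatSum

theorem measurable_sigmaPlus : Measurable sigmaPlus := measurable_one.indicator measurableSet_Ioi

theorem norm_sigmaPlus_le (x : ℝ) : ‖sigmaPlus x‖ ≤ 1 := by
  rw [sigmaPlus, Set.indicator_apply]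
  split_ifs <;> simp

theorem BddMeas.sigmaPlus_mul {h : ℝ → ℂ} (hh : BddMeas h) : BddMeas (sigmaPlus * h) := by
  obtain ⟨hm, C, hC⟩ := hh
  refine ⟨measurable_sigmaPlus.mul hm, 1 * C, fun x => ?_⟩
  rw [Pi.mul_apply, norm_mul]
  exact mul_le_mul (norm_sigmaPlus_le x) (hC x) (norm_nonneg _) zero_le_one

/-- The integrand attached to a forest: each node `i` carries the function `f (dec i)` in its own
variable, and the indicator of positivity of the sum of the variables below it. -/
def forestDensity (f : ℕ+ → ℝ → ℂ) {F : PForest} (x : Node F → ℝ) : ℂ :=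
  (∏ i, f (dec i) (x i)) * ∏ i, sigmaPlus (hatSum x i)

theorem integrable_forestDensity {f : ℕ+ → ℝ → ℂ} (hf : ∀ ω, Integrable (f ω)) (F : PForest) :
    Integrable fun x : Node F → ℝ => forestDensity f x := by
  have h : Integrable fun x : Node F → ℝ => ∏ i, f (dec i) (x i) :=
    Integrable.fintype_prod fun i => hf (dec i)
  refine h.mul_bdd (c := 1) (Measurable.aestronglyMeasurable ?_)
    (Filter.Eventually.of_forall fun x => ?_)
  · refine Finset.measurable_prod _ fun i _ => measurable_sigmaPlus.comp ?_
    exact Finset.measurable_sum _ fun j _ => measurable_pi_apply j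
  · rw [norm_prod]
    exact Finset.prod_le_one (fun i _ => norm_nonneg _) fun i _ => norm_sigmaPlus_le _

/-- The positivity condition at the root is the only coupling between the root and the nodes below
it, and the other trees are independent of both. -/
theorem forestDensity_cons (f : ℕ+ → ℝ → ℂ) (ω : ℕ+) {c r : PForest}
    (x : Node (cons ω c r) → ℝ) :
    forestDensity f x = f ω (x (Node.root ω c r)) *
      (sigmaPlus (x (Node.root ω c r) + ∑ j, x (Node.under ω r j)) *
        (forestDensity f (fun j => x (Node.under ω r j)) *
          forestDensity f (fun j => x (Node.beside ω c j)))) := by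
  simp only [forestDensity, prod_node_cons, hatSum_root, hatSum_under, hatSum_beside, dec]
  ring

/-- Splitting the variables of a forest into those of the first root, of the nodes below it and of
the other trees. -/
def nodeVars (ω : ℕ+) (c r : PForest) :
    ℝ × (Node c → ℝ) × (Node r → ℝ) ≃ᵐ (Node (cons ω c r) → ℝ) :=
  ((((MeasurableEquiv.funUnique Unit ℝ).symm.prodCongr
    (MeasurableEquiv.sumPiEquivProdPi fun _ : Node c ⊕ Node r => ℝ).symm).trans
    (MeasurableEquiv.sumPiEquivProdPi fun _ : Unit ⊕ (Node c ⊕ Node r) => ℝ).symm).trans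
    (MeasurableEquiv.piCongrLeft (fun _ => ℝ) (nodeEquiv ω c r)))

theorem measurePreserving_nodeVars (ω : ℕ+) (c r : PForest) :
    MeasurePreserving (nodeVars ω c r) :=
  ((((volume_preserving_funUnique Unit ℝ).symm _).prod
    (volume_measurePreserving_sumPiEquivProdPi_symm fun _ : Node c ⊕ Node r => ℝ)).trans
    (volume_measurePreserving_sumPiEquivProdPi_symm _)).trans
    (volume_measurePreserving_piCongrLeft _ _)

section nodeVars

variable (ω : ℕ+) {c r : PForest} (s : ℝ) (y : Node c → ℝ) (z : Node r → ℝ)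

theorem nodeVars_root : nodeVars ω c r (s, y, z) (Node.root ω c r) = s := rfl

theorem nodeVars_under (i : Node c) : nodeVars ω c r (s, y, z) (Node.under ω r i) = y i := rfl

theorem nodeVars_beside (i : Node r) : nodeVars ω c r (s, y, z) (Node.beside ω c i) = z i := rfl

end nodeVars

/-- Fubini in the order root, nodes below, other trees. This nesting is the one produced by applying
`pairing_mul` twice. -/
theorem integral_forestDensity_cons {f : ℕ+ → ℝ → ℂ} (hf : ∀ ω, Integrable (f ω)) (ω : ℕ+)
    (c r : PForest) {h : ℝ → ℂ} (hh : BddMeas h) :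
    ∫ x : Node (cons ω c r) → ℝ, forestDensity f x * h (∑ i, x i)
      = ∫ s, f ω s * ∫ y : Node c → ℝ, forestDensity f y * (sigmaPlus (s + ∑ j, y j) *
          ∫ z : Node r → ℝ, forestDensity f z * h (s + ∑ j, y j + ∑ j, z j)) := by
  have hi : Integrable fun x : Node (cons ω c r) → ℝ => forestDensity f x * h (∑ i, x i) :=
    hh.integrable_mul (integrable_forestDensity hf _)
      (Finset.measurable_sum _ fun j _ => measurable_pi_apply j)
  have hp := measurePreserving_nodeVars ω c r
  have hi' := (hp.integrable_comp_emb (nodeVars ω c r).measurableEmbedding).mpr hi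
  rw [← hp.integral_comp' (fun x => forestDensity f x * h (∑ i, x i))]
  have e : ∀ p, forestDensity f (nodeVars ω c r p) * h (∑ i, nodeVars ω c r p i)
      = f ω p.1 * (forestDensity f p.2.1 * (sigmaPlus (p.1 + ∑ j, p.2.1 j) *
          (forestDensity f p.2.2 * h (p.1 + ∑ j, p.2.1 j + ∑ j, p.2.2 j)))) := by
    rintro ⟨s, y, z⟩
    rw [forestDensity_cons, sum_node_cons]
    simp only [nodeVars_root, nodeVars_under, nodeVars_beside, add_assoc]
    ring
  simp only [Function.comp_def, e] at hi' ⊢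
  refine (integral_prod _ hi').trans (integral_congr_ae ?_)
  -- The second use of Fubini needs an integrable slice, available for almost every `s`.
  filter_upwards [hi'.prod_right_ae] with s hs
  refine (integral_prod _ hs).trans ?_
  simp only [integral_const_mul]

/-! ### The induction on forests and the proposition -/

/-- The test function must be arbitrary for the induction to close: for the trees beside the root it
becomes a translate of `h`, and for the nodes below the root a translate of σ₊ times a pairing. -/
theorem pairing_atkinsonRev_arborifyPlanar (F : PForest) (β : ℝ → ℂ)
    (hβ : AnalyticOnNhd ℝ β Set.univ) (hf : ∀ ω : ℕ+, ∫ x, ‖fFun β ω x‖ = 1) :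
    ∀ {h : ℝ → ℂ}, BddMeas h →
    pairing (atkinsonRev rotaBaxter (gamma β hβ hf) (-1) (arborifyPlanar F)) h
      = (-1) ^ Fintype.card (Node F) *
        ∫ x : Node F → ℝ, forestDensity (fFun β) x * h (∑ i, x i) := by
  induction F with
  | nil =>
    intro h _
    rw [arborifyPlanar, show (1 : Hqsh) = Hqsh.word [] from rfl, atkinsonRev_nil, pairing_one_left]
    -- The integral runs over a single point of mass 1 with empty sum, hence equals h(0), the
    -- pairing with δ.
    have : IsEmpty (Node nil) := ⟨fun i => nomatch i⟩
    simp [forestDensity, Measure.real, volume_pi]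
  | cons ω c r ihc ihr =>
    intro h hh
    -- `H s` integrates out the trees beside the root when the first tree has total `s`. As an
    -- opaque name it stays folded during the rewriting.
    obtain ⟨H, hHr⟩ : ∃ H : ℝ → ℂ, H = fun s =>
      pairing (atkinsonRev rotaBaxter (gamma β hβ hf) (-1) (arborifyPlanar r)) fun y => h (s + y) :=
      ⟨_, rfl⟩
    have hH : BddMeas H := hHr ▸ hh.pairing_comp_add _
    rw [arborifyPlanar, atkinsonRev_mul rotaBaxter_mul_rotaBaxter, atkinsonRev_L, neg_smul, one_smul,
      neg_mul, pairing_neg, pairing_mul _ _ hh, gamma_pow, ← hHr, pairing_rotaBaxter_inr_mul,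
      pairing_mul _ _ hH.sigmaPlus_mul, pairing_inr,
      integral_forestDensity_cons (fun ω => (fFun_mem hβ (hf ω)).2.1) ω c r hh, card_node_cons]
    simp only [ihc (hH.sigmaPlus_mul.comp_add _)]
    simp only [Pi.mul_apply, hHr, ihr (hh.comp_add _)]
    -- The signs of `r` and then of `c` are moved out of the integrals; the remaining factor -1
    -- belongs to the root.
    simp only [mul_left_comm _ ((-1 : ℂ) ^ Fintype.card (Node r)), integral_const_mul]
    simp only [mul_left_comm (fFun β _ _), integral_const_mul]
    ring

end DiffusionAverage

end
open DiffusionAverage MeasureTheory in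
theorem mainTheorem6 (β : ℝ → ℂ) (hβ : AnalyticOnNhd ℝ β Set.univ)
    (hf : ∀ ω : ℕ+, ∫ x, ‖fFun β ω x‖ = 1) (F : PForest) :
    Integrable (fun x : PForest.Node F → ℝ =>
      (∏ i, fFun β (PForest.dec i) (x i)) * ∏ i, sigmaPlus (hatSum x i)) ∧
    phiDiffusionAnti β hβ hf (Hck.of F) =
      (-1) ^ Fintype.card (PForest.Node F) *
        ∫ x : PForest.Node F → ℝ,
          (∏ i, fFun β (PForest.dec i) (x i)) * ∏ i, sigmaPlus (hatSum x i) := by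
  refine ⟨integrable_forestDensity (fun ω => (fFun_mem hβ (hf ω)).2.1) F, ?_⟩
  -- Pairing with the constant 1 is Θ, and the factor involving the total sum disappears.
  have h := pairing_atkinsonRev_arborifyPlanar F β hβ hf (h := 1)
    ⟨measurable_one, 1, fun x => by simp⟩
  rw [pairing_one_right] at h
  simp only [Pi.one_apply, mul_one, forestDensity] at h
  rw [← h, ← arborify_of]
  rfl
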